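/- Let $(S,\rho)$ be a compact metric space with a finite Borel measure $\nu$ without atoms ($\nu(\{\zeta\})=0$ for all $\zeta\in S$). Let $S^\infty$ be the set of finite subsets of $S$, with the $\sigma$-algebra generated by the counts $N_A(x)=\#(x\cap A)$, $A\subset S$ Borel, and with the Hausdorff distance $d_H$, where $d_H(\emptyset,y)=\infty$ for $y\neq\emptyset$. Let $\mathrm{Poisson}(S,1)$ be the law on $S^\infty$ under which each $N_A$ is Poisson distributed with mean $\nu(A)$ and $N_{A_1},\dots,N_{A_n}$ are independent for disjoint $A_1,\dots,A_n$. Let $(X,Y)$ be a random element of $S^\infty\times\{0,\dots,M\}$ with $M\ge 0$. Suppose that, for every $j\in\{0,\dots,M\}$ with $\mathbb P(Y=j)>0$, the law of $X$ given $Y=j$ is that of a Gibbs process with energy $$U_j(\{x_1,\dots,x_n\})=\sum_{i=1}^n\varphi_j(x_i)+\sum_{1\le i<k\le n}\psi_j(\rho(x_i,x_k)),$$ where $\varphi_j:S\to\mathbb R$ and $\psi_j:[0,\infty)\to\mathbb R$ are continuous; that is, $\exp(-U_j)$ is integrable with respect to $\mathrm{Poisson}(S,1)$ and the law of $X$ given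 $Y=j$ has density $c_j\exp(-U_j)$ with respect to $\mathrm{Poisson}(S,1)$, for a constant $c_j>0$. Let $P_X$ be the law of $X$ and $B_{d_H}(x,\delta)$ the closed ball of radius $\delta$ about $x$. Then every version $\eta$ of the regression function $\eta(x)=\mathbb E(Y\mid X=x)$ satisfies the Besicovitch condition with respect to $d_H$: $$\lim_{\varepsilon\to0}P_X\Big\{x:\ \lim_{\delta\to0}\frac1{P_X(B_{d_H}(x,\delta))}\int_{B_{d_H}(x,\delta)}|\eta(x)-\eta(y)|\,dP_X(y)>\varepsilon\Big\}=0,$$ where the inner limit exists for $P_X$-almost every $x$. Moreover, there is a version $\eta$ of the regression function for which the inner limit exists and equals $0$ at every $x\in S^\infty$ such that $P_X(B_{d_H}(x,\delta))>0$ for all $\delta>0$. -/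

import Mathlib

open MeasureTheory ProbabilityTheory Filter Topology
open scoped ENNReal NNReal

namespace PointConfig

/-- A configuration: a finite subset of `S`, possibly empty. This is a wrapper of `Finset S`, which
carries in Mathlib the σ-algebra generated by the events `ξ ∈ x`; that one is too small here. -/
@[ext]
structure Config (S : Type*) where
  /-- The finite set of the points of the configuration. -/
  points : Finset S

/-- The number of points of the configuration `x` that lie in `A`. -/
noncomputable def count {S : Type*} (A : Set S) (x : Config S) : ℕ :=
  ((x.points : Set S) ∩ A).ncard

/-- The σ-algebra on the space of configurations generated by the counting variables of
the measurable subsets of `S`. -/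
noncomputable instance instMeasurableSpace {S : Type*} [MeasurableSpace S] :
    MeasurableSpace (Config S) :=
  ⨆ A : {A : Set S // MeasurableSet A}, MeasurableSpace.comap (count A.1) ⊤

/-- `L` is the law of a Poisson process on `S` with mean measure `ν`, that is, with intensity
function `1` with respect to `ν`: the number of points in a Borel set `A` is Poisson distributed
with mean `ν A`, and the numbers of points in disjoint Borel sets are independent. -/
structure IsPoissonLaw {S : Type*} [MeasurableSpace S] (ν : Measure S)
    (L : Measure (Config S)) : Prop where
  isProbabilityMeasure : IsProbabilityMeasure L
  map_count : ∀ A : Set S, MeasurableSet A →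
    L.map (count A) = poissonMeasure (ν A).toNNReal
  iIndepFun_count : ∀ (n : ℕ) (A : Fin n → Set S), (∀ i, MeasurableSet (A i)) →
    Pairwise (Function.onFun Disjoint A) → iIndepFun (fun i => count (A i)) L

/-- The pairwise energy `∑ i, φ (x i) + ∑ i < j, ψ (ρ (x i, x j))` of the configuration
`{x 1, …, x n}`. The second sum is over unordered pairs of distinct points, hence half of the sum
over ordered pairs. -/
noncomputable def energy {S : Type*} [MetricSpace S] (φ : S → ℝ) (ψ : ℝ → ℝ) (x : Config S) : ℝ :=
  open Classical in
  ∑ ξ ∈ x.points, φ ξ + (1 / 2) * ∑ p ∈ x.points.offDiag, ψ (dist p.1 p.2)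

/-- `Q` is the law of a Gibbs process with pairwise energy `energy φ ψ`: for some constant `c`, it
has density `c * exp (-energy φ ψ)` with respect to the law of the Poisson process with
intensity `1`. The energy is admissible: `exp (-energy φ ψ)` has a finite integral. -/
def IsGibbsLaw {S : Type*} [MetricSpace S] [MeasurableSpace S] (ν : Measure S)
    (φ : S → ℝ) (ψ : ℝ → ℝ) (Q : Measure (Config S)) : Prop :=
  ∃ L : Measure (Config S), IsPoissonLaw ν L ∧
    ∫⁻ x, ENNReal.ofReal (Real.exp (-energy φ ψ x)) ∂L ≠ ∞ ∧
    ∃ c : ℝ, 0 < c ∧ Q = L.withDensity (fun x => ENNReal.ofReal (c * Real.exp (-energy φ ψ x)))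

/-- The closed ball of radius `δ` about the configuration `x` for the Hausdorff distance. The
extended Hausdorff distance is used, for which the empty configuration is at distance `∞` from
every other one; between nonempty configurations it is the usual, finite Hausdorff distance. -/
def hausdorffBall {S : Type*} [MetricSpace S] (x : Config S) (δ : ℝ) : Set (Config S) :=
  {y | Metric.hausdorffEDist (y.points : Set S) (x.points : Set S) ≤ ENNReal.ofReal δ}

/-- The mean of `|η x - η y|` over `y` in the Hausdorff ball of radius `δ` about `x`. -/
noncomputable def meanOsc {S : Type*} [MetricSpace S] [MeasurableSpace S]
    (μ : Measure (Config S)) (η : Config S → ℝ) (x : Config S) (δ : ℝ) : ℝ :=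
  (1 / μ.real (hausdorffBall x δ)) * ∫ y in hausdorffBall x δ, |η x - η y| ∂μ

/-- The Besicovitch condition for `η` and `μ` with respect to the Hausdorff distance: as `ε → 0`,
the measure of the set of those `x` for which it is not the case that `meanOsc μ η x δ` converges,
as `δ → 0`, to a limit that is at most `ε`, tends to `0`. -/
def BesicovitchCondition {S : Type*} [MetricSpace S] [MeasurableSpace S]
    (μ : Measure (Config S)) (η : Config S → ℝ) : Prop :=
  Tendsto (fun ε : ℝ => μ {x | ¬ ∃ l : ℝ, l ≤ ε ∧ Tendsto (meanOsc μ η x) (𝓝[>] 0) (𝓝 l)})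
    (𝓝[>] 0) (𝓝 0)

/-- `η` is a version of the regression function `η x = E (Y | X = x)`. -/
def IsRegressionFunction {Ω S : Type*} [MeasurableSpace S] [MeasurableSpace Ω] {M : ℕ}
    (P : Measure Ω) (X : Ω → Config S) (Y : Ω → Fin (M + 1)) (η : Config S → ℝ) : Prop :=
  Measurable η ∧ (fun ω => η (X ω)) =ᵐ[P]
    P[fun ω => ((Y ω : ℕ) : ℝ) | MeasurableSpace.comap X instMeasurableSpace]

end PointConfig

/-! With respect to the Poisson law `L`, the joint law of `X` and `{Y = j}` has density `f j = a j *
exp (-U_j)`, so Bayes' formula gives the version `H = ∑ j * f j / ∑ f j` of the regression function.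
Energies are continuous in the positions of a fixed number of points, hence so are `F = ∑ f j` and
`H`. The obstacle is that every Hausdorff ball may also contain configurations with several points
near one point of `x`, and there `H` need not be close to `H x`.

These crowded configurations are negligible, for two reasons. First, admissibility implies stability
(`sum_pairs_nonneg`, `exists_exp_neg_energy_le`): were the full pair sum negative at some
configuration of `m` points in the support of `ν`, placing `t` points near each of them would give a
weight of order `exp (g * t ^ 2)`, which beats the Poisson probability of order `D ^ t / t! ^ m`,
and `exp (-U)` would not be integrable. Hence `F` is at most exponential in the number of points,
almost surely. Second, under `L` each point beyond one per ball costs a factor `ν (ball)`, which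
tends to `0` as `ν` has no atoms; even with exponential weights, the crowded part of a small ball is
small against the part with as many points as `x` (`eventually_setLIntegral_pow_card_le`).

So the mean oscillation of `H` tends to `0` at every `x`, and any other version agrees with `H`
almost everywhere. -/

namespace PointConfig

/-! ### Counting variables. -/

section Count

variable {S : Type*}

lemma count_eq_card_filter (A : Set S) (x : Config S) [DecidablePred (· ∈ A)] :
    count A x = (x.points.filter (· ∈ A)).card := by
  rw [count, ← Set.ncard_coe_finset]
  congr 1
  ext z
  simp

lemma count_univ (x : Config S) : count Set.univ x = x.points.card := by
  simp [count]

lemma count_eq_zero_iff {A : Set S} {x : Config S} :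
    count A x = 0 ↔ ∀ z ∈ x.points, z ∉ A := by
  classical
  rw [count_eq_card_filter, Finset.card_eq_zero, Finset.filter_eq_empty_iff]

lemma one_le_count_iff {A : Set S} {x : Config S} :
    1 ≤ count A x ↔ ∃ z ∈ x.points, z ∈ A := by
  rw [Nat.one_le_iff_ne_zero, Ne, count_eq_zero_iff]
  push Not
  rfl

lemma measurable_count [MeasurableSpace S] {A : Set S} (hA : MeasurableSet A) :
    Measurable (count A) := by
  have h : MeasurableSpace.comap (count A) ⊤ ≤ (instMeasurableSpace : MeasurableSpace (Config S)) :=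
    le_iSup (fun A : {A : Set S // MeasurableSet A} => MeasurableSpace.comap (count A.1) ⊤) ⟨A, hA⟩
  exact fun s hs => h _ ⟨s, hs, rfl⟩

/-- A sum over the points of a configuration of a function of finitely many values. -/
lemma sum_comp_eq_sum_count {ι : Type*} (x : Config S) (c : S → ι) (I : Finset ι)
    (hc : ∀ z ∈ x.points, c z ∈ I) (h : ι → ℝ) :
    ∑ z ∈ x.points, h (c z) = ∑ a ∈ I, (count (c ⁻¹' {a}) x : ℝ) * h a := by
  classical
  rw [← Finset.sum_fiberwise_of_maps_to hc]
  refine Finset.sum_congr rfl fun a _ => ?_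
  rw [Finset.sum_congr rfl (g := fun _ => h a) (fun z hz => by rw [(Finset.mem_filter.1 hz).2]),
    Finset.sum_const, nsmul_eq_mul, count_eq_card_filter]
  simp

end Count

/-! ### Measurability of the energy. -/

section Energy

variable {S : Type*} [MetricSpace S]

/-- Adding the diagonal turns the pair sum into a full double sum, which can be evaluated one
variable at a time. -/
lemma energy_eq (φ : S → ℝ) (ψ : ℝ → ℝ) (x : Config S) :
    energy φ ψ x = ∑ z ∈ x.points, φ z + (1 / 2) *
      (∑ z ∈ x.points, ∑ w ∈ x.points, ψ (dist z w) - x.points.card * ψ 0) := by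
  classical
  have h := Finset.sum_union (f := fun p : S × S => ψ (dist p.1 p.2))
    (Finset.disjoint_diag_offDiag x.points)
  rw [Finset.diag_union_offDiag, Finset.sum_product, Finset.sum_diag] at h
  simp only [dist_self, Finset.sum_const, nsmul_eq_mul] at h
  rw [h, energy]
  simp only [add_sub_cancel_left]

/-- Moving points by simple functions `r n` that converge to the identity makes the sum a finite
linear combination of counts; continuity of `φ` allows the passage to the limit. -/
lemma measurable_sum_points [CompactSpace S] [MeasurableSpace S] [BorelSpace S]
    {φ : S → ℝ} (hφ : Continuous φ) :
    Measurable fun x : Config S => ∑ z ∈ x.points, φ z := by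
  rcases isEmpty_or_nonempty S with hS | ⟨⟨s₀⟩⟩
  · have : (fun x : Config S => ∑ z ∈ x.points, φ z) = fun _ => 0 := by
      ext x; exact Finset.sum_eq_zero fun z _ => hS.elim z
    rw [this]; exact measurable_const
  let r := SimpleFunc.approxOn (id : S → S) measurable_id Set.univ s₀ (Set.mem_univ _)
  have hr : ∀ z, Tendsto (fun n => r n z) atTop (𝓝 z) := fun z =>
    SimpleFunc.tendsto_approxOn measurable_id _ (by simp)
  refine measurable_of_tendsto_metrizable (f := fun n x => ∑ z ∈ x.points, φ (r n z))
    (fun n => ?_) (tendsto_pi_nhds.2 fun x => tendsto_finsetSum _ fun z _ =>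
      (hφ.tendsto z).comp (hr z))
  have (x : Config S) := sum_comp_eq_sum_count x (r n) (r n).range
    (fun z _ => SimpleFunc.mem_range_self _ z) φ
  simp_rw [this]
  exact Finset.measurable_sum _ fun a _ =>
    (measurable_from_top.comp (measurable_count ((r n).measurableSet_fiber a))).mul_const _

lemma measurable_sum_pairs [CompactSpace S] [MeasurableSpace S] [BorelSpace S]
    {g : S → S → ℝ} (hg : Continuous (Function.uncurry g)) :
    Measurable fun x : Config S => ∑ z ∈ x.points, ∑ w ∈ x.points, g z w := by
  rcases isEmpty_or_nonempty S with hS | ⟨⟨s₀⟩⟩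
  · have : (fun x : Config S => ∑ z ∈ x.points, ∑ w ∈ x.points, g z w) = fun _ => 0 := by
      ext x; exact Finset.sum_eq_zero fun z _ => hS.elim z
    rw [this]; exact measurable_const
  let r := SimpleFunc.approxOn (id : S → S) measurable_id Set.univ s₀ (Set.mem_univ _)
  have hr : ∀ z, Tendsto (fun n => r n z) atTop (𝓝 z) := fun z =>
    SimpleFunc.tendsto_approxOn measurable_id _ (by simp)
  have hlim : Tendsto (fun n (x : Config S) => ∑ z ∈ x.points, ∑ w ∈ x.points, g (r n z) (r n w))
      atTop (𝓝 fun x => ∑ z ∈ x.points, ∑ w ∈ x.points, g z w) := by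
    refine tendsto_pi_nhds.2 fun x => tendsto_finsetSum _ fun z _ => tendsto_finsetSum _ fun w _ => ?_
    have h1 : Tendsto (fun n => (r n z, r n w)) atTop (𝓝 (z, w)) := (hr z).prodMk_nhds (hr w)
    exact (hg.tendsto (z, w)).comp h1
  refine measurable_of_tendsto_metrizable (fun n => ?_) hlim
  have h (x : Config S) (h : S → ℝ) := sum_comp_eq_sum_count x (r n) (r n).range
    (fun z _ => SimpleFunc.mem_range_self _ z) h
  have h2 (x : Config S) : ∑ z ∈ x.points, ∑ w ∈ x.points, g (r n z) (r n w) =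
      ∑ a ∈ (r n).range, (count (r n ⁻¹' {a}) x : ℝ) *
        ∑ b ∈ (r n).range, (count (r n ⁻¹' {b}) x : ℝ) * g a b := by
    rw [← h x fun a => ∑ b ∈ (r n).range, (count (r n ⁻¹' {b}) x : ℝ) * g a b]
    exact Finset.sum_congr rfl fun z _ => h x (g (r n z))
  simp only [h2]
  have hm (a : S) : Measurable fun x : Config S => (count (r n ⁻¹' {a}) x : ℝ) :=
    measurable_from_top.comp (measurable_count ((r n).measurableSet_fiber a))
  exact Finset.measurable_sum _ fun a _ =>
    (hm a).mul (Finset.measurable_sum _ fun b _ => (hm b).mul_const _)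

lemma measurable_energy [CompactSpace S] [MeasurableSpace S] [BorelSpace S]
    {φ : S → ℝ} {ψ : ℝ → ℝ} (hφ : Continuous φ) (hψ : ContinuousOn ψ (Set.Ici 0)) :
    Measurable (energy φ ψ) := by
  have h : Continuous (Function.uncurry fun z w : S => ψ (dist z w)) :=
    hψ.comp_continuous continuous_dist fun p => dist_nonneg
  have hc : Measurable fun x : Config S => (x.points.card : ℝ) := by
    simp_rw [← count_univ]
    exact measurable_from_top.comp (measurable_count MeasurableSet.univ)
  rw [show energy φ ψ = _ from funext (energy_eq φ ψ)]
  exact (measurable_sum_points hφ).add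
    (((measurable_sum_pairs h).sub (hc.mul_const _)).const_mul _)

end Energy

/-! ### Hausdorff balls in terms of counts. -/

section Ball

variable {S : Type*} [MetricSpace S]

lemma mem_hausdorffBall_iff {x y : Config S} {δ : ℝ} (hδ : 0 ≤ δ) :
    y ∈ hausdorffBall x δ ↔ (∀ z ∈ y.points, ∃ w ∈ x.points, dist z w ≤ δ) ∧
      ∀ w ∈ x.points, ∃ z ∈ y.points, dist z w ≤ δ := by
  have key : ∀ (s t : Finset S), Metric.hausdorffEDist (s : Set S) t ≤ ENNReal.ofReal δ →
      ∀ z ∈ s, ∃ w ∈ t, dist z w ≤ δ := by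
    intro s t h z hz
    have h1 := (Metric.infEDist_le_hausdorffEDist_of_mem (t := (t : Set S))
      (Finset.mem_coe.2 hz)).trans h
    -- The distance to the empty set is `∞`; for nonempty finite `t` the infimum is attained.
    have ht : (t : Set S).Nonempty := by
      rw [Set.nonempty_iff_ne_empty]
      intro h0
      rw [h0, Metric.infEDist_empty] at h1
      exact absurd h1 (by simp)
    obtain ⟨w, hw, hzw⟩ := t.finite_toSet.isCompact.exists_infEDist_eq_edist ht z
    refine ⟨w, hw, ?_⟩
    rwa [hzw, edist_dist, ENNReal.ofReal_le_ofReal_iff hδ] at h1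
  constructor
  · intro h
    refine ⟨key _ _ h, fun w hw => ?_⟩
    have h' : Metric.hausdorffEDist (x.points : Set S) y.points ≤ ENNReal.ofReal δ := by
      rw [Metric.hausdorffEDist_comm]; exact h
    obtain ⟨z, hz, hzw⟩ := key _ _ h' w hw
    exact ⟨z, hz, by rwa [dist_comm]⟩
  · rintro ⟨h1, h2⟩
    refine Metric.hausdorffEDist_le_of_mem_edist (fun z hz => ?_) fun w hw => ?_
    · obtain ⟨w, hw, h⟩ := h1 z hz
      exact ⟨w, hw, by rw [edist_dist]; exact ENNReal.ofReal_le_ofReal h⟩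
    · obtain ⟨z, hz, h⟩ := h2 w hw
      exact ⟨z, hz, by rw [edist_comm, edist_dist]; exact ENNReal.ofReal_le_ofReal h⟩

/-- The union of the closed balls of radius `δ` about the points of `x`. -/
def thick (x : Config S) (δ : ℝ) : Set S :=
  ⋃ w : x.points, Metric.closedBall (w : S) δ

/-- Gives measurability of the ball, and access to its Poisson probability through independence of
counts. -/
lemma mem_hausdorffBall_iff_count {x y : Config S} {δ : ℝ} (hδ : 0 ≤ δ) :
    y ∈ hausdorffBall x δ ↔ count (thick x δ)ᶜ y = 0 ∧
      ∀ w : x.points, 1 ≤ count (Metric.closedBall (w : S) δ) y := by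
  rw [mem_hausdorffBall_iff hδ, count_eq_zero_iff]
  simp [one_le_count_iff, thick]

lemma isClosed_thick (x : Config S) (δ : ℝ) : IsClosed (thick x δ) :=
  isClosed_iUnion_of_finite fun _ => Metric.isClosed_closedBall

lemma measurableSet_hausdorffBall [MeasurableSpace S] [BorelSpace S] (x : Config S) {δ : ℝ}
    (hδ : 0 ≤ δ) : MeasurableSet (hausdorffBall x δ) := by
  have : hausdorffBall x δ = count (thick x δ)ᶜ ⁻¹' {0} ∩
      ⋂ w : x.points, count (Metric.closedBall (w : S) δ) ⁻¹' {k | 1 ≤ k} := by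
    ext y
    rw [mem_hausdorffBall_iff_count hδ]
    simp
  rw [this]
  exact (measurable_count (isClosed_thick x δ).measurableSet.compl (by measurability)).inter
    (MeasurableSet.iInter fun w => measurable_count measurableSet_closedBall (by measurability))

lemma hausdorffBall_mono (x : Config S) {δ ε : ℝ} (h : δ ≤ ε) :
    hausdorffBall x δ ⊆ hausdorffBall x ε :=
  fun _ hy => le_trans hy (ENNReal.ofReal_le_ofReal h)

end Ball

/-! ### Poisson variables and Poisson laws. -/

lemma lintegral_poissonMeasure (r : ℝ≥0) (f : ℕ → ℝ≥0∞) :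
    ∫⁻ k, f k ∂poissonMeasure r =
      ∑' k : ℕ, ENNReal.ofReal (Real.exp (-r) * r ^ k / k.factorial) * f k := by
  simp [poissonMeasure, lintegral_sum_measure]

/-- Without the term `k = 0` one factor `D * r` splits off, and `k! ≤ (k + 1)!` leaves an
exponential series. -/
lemma lintegral_pow_poissonMeasure_le (r : ℝ≥0) {D : ℝ} (hD : 0 ≤ D) :
    ∫⁻ k, (if 1 ≤ k then ENNReal.ofReal (D ^ k) else 0) ∂poissonMeasure r ≤
      ENNReal.ofReal (D * Real.exp (D * r)) * r := by
  have hs : HasSum (fun k : ℕ => (D * r) ^ k / k.factorial) (Real.exp (D * r)) := by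
    rw [Real.exp_eq_exp_ℝ]; exact NormedSpace.expSeries_div_hasSum_exp (D * (r : ℝ))
  rw [lintegral_poissonMeasure, tsum_eq_zero_add' ENNReal.summable]
  simp only [nonpos_iff_eq_zero, one_ne_zero, if_false, mul_zero, zero_add,
    Nat.le_add_left, if_true]
  calc ∑' k : ℕ, ENNReal.ofReal (Real.exp (-r) * r ^ (k + 1) / (k + 1).factorial) *
        ENNReal.ofReal (D ^ (k + 1))
      ≤ ∑' k : ℕ, ENNReal.ofReal (D * r) * ENNReal.ofReal ((D * r) ^ k / k.factorial) := by
        refine ENNReal.tsum_le_tsum fun k => ?_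
        rw [← ENNReal.ofReal_mul (by positivity), ← ENNReal.ofReal_mul (by positivity)]
        refine ENNReal.ofReal_le_ofReal ?_
        have h1 : Real.exp (-r) ≤ 1 := Real.exp_le_one_iff.2 (by simp)
        have h2 : ((k.factorial : ℕ) : ℝ) ≤ (k + 1).factorial :=
          Nat.cast_le.2 (Nat.factorial_le (Nat.le_succ k))
        calc Real.exp (-r) * r ^ (k + 1) / (k + 1).factorial * D ^ (k + 1)
            ≤ 1 * r ^ (k + 1) / k.factorial * D ^ (k + 1) := by gcongr
          _ = D * r * ((D * r) ^ k / k.factorial) := by ring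
    _ = ENNReal.ofReal (D * Real.exp (D * r)) * r := by
        rw [ENNReal.tsum_mul_left, ← ENNReal.ofReal_tsum_of_nonneg (fun k => by positivity)
          hs.summable, hs.tsum_eq, ← ENNReal.ofReal_coe_nnreal, ← ENNReal.ofReal_mul (by positivity),
          ← ENNReal.ofReal_mul (by positivity)]
        congr 1; ring

namespace IsPoissonLaw

variable {S : Type*} [MeasurableSpace S] {ν : Measure S} {L : Measure (Config S)}

lemma iIndepFun_fintype (hL : IsPoissonLaw ν L) {ι : Type*} [Fintype ι] {A : ι → Set S}
    (hA : ∀ i, MeasurableSet (A i)) (hd : Pairwise (Function.onFun Disjoint A)) :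
    iIndepFun (fun i => count (A i)) L := by
  let e := Fintype.equivFin ι
  have h := hL.iIndepFun_count _ (A ∘ e.symm) (fun i => hA _) fun i j hij =>
    hd (e.symm.injective.ne hij)
  simpa using h.precomp e.injective

lemma lintegral_prod_count (hL : IsPoissonLaw ν L) {ι : Type*} [Fintype ι] {A : ι → Set S}
    (hA : ∀ i, MeasurableSet (A i)) (hd : Pairwise (Function.onFun Disjoint A))
    (g : ι → ℕ → ℝ≥0∞) :
    ∫⁻ x, ∏ i, g i (count (A i) x) ∂L =
      ∏ i, ∫⁻ k, g i k ∂poissonMeasure (ν (A i)).toNNReal := by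
  have hi := (hL.iIndepFun_fintype hA hd).comp g fun i => measurable_from_top
  have := lintegral_prod_eq_prod_lintegral_of_indepFun Finset.univ _ hi
    fun i => measurable_from_top.comp (measurable_count (hA i))
  simp only [Function.comp_apply] at this
  rw [this]
  refine Finset.prod_congr rfl fun i _ => ?_
  rw [← hL.map_count _ (hA i), lintegral_map measurable_from_top (measurable_count (hA i))]

lemma measure_count_eq (hL : IsPoissonLaw ν L) {ι : Type*} [Fintype ι] {A : ι → Set S}
    (hA : ∀ i, MeasurableSet (A i)) (hd : Pairwise (Function.onFun Disjoint A)) (k : ι → ℕ) :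
    L {x | ∀ i, count (A i) x = k i} = ∏ i, ENNReal.ofReal
      (Real.exp (-(ν (A i)).toNNReal) * (ν (A i)).toNNReal ^ k i / (k i).factorial) := by
  have h1 : {x : Config S | ∀ i, count (A i) x = k i} =
      ⋂ i ∈ (Finset.univ : Finset ι), count (A i) ⁻¹' {k i} := by ext; simp
  rw [h1, (hL.iIndepFun_fintype hA hd).measure_inter_preimage_eq_mul Finset.univ
    (fun i _ => by measurability)]
  refine Finset.prod_congr rfl fun i _ => ?_
  rw [← poissonMeasure_singleton, ← hL.map_count _ (hA i), Measure.map_apply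
    (measurable_count (hA i)) (by measurability)]

/-- The law of a Poisson process is determined by its mean measure. -/
lemma unique {L' : Measure (Config S)} (hL : IsPoissonLaw ν L) (hL' : IsPoissonLaw ν L') :
    L = L' := by
  classical
  have := hL.isProbabilityMeasure
  have := hL'.isProbabilityMeasure
  let ι := {A : Set S // MeasurableSet A}
  let m : ι → MeasurableSpace (Config S) := fun A => MeasurableSpace.comap (count A.1) ⊤
  have hgen : (instMeasurableSpace : MeasurableSpace (Config S)) =
      MeasurableSpace.generateFrom (piiUnionInter (fun n => {s | MeasurableSet[m n] s}) Set.univ) := by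
    refine Eq.trans ?_ (generateFrom_piiUnionInter_measurableSet m Set.univ).symm
    simp [m, instMeasurableSpace, ι]
  refine ext_of_generate_finite _ hgen (isPiSystem_piiUnionInter _
    (fun n => @MeasurableSpace.isPiSystem_measurableSet _ (m n)) _) ?_ (by simp)
  rintro _ ⟨T, -, f, hf, rfl⟩
  have hf' : ∀ A : ι, ∃ s : Set ℕ, A ∈ T → f A = count A.1 ⁻¹' s := fun A => by
    by_cases hA : A ∈ T
    · obtain ⟨s, -, hs⟩ := hf A hA
      exact ⟨s, fun _ => hs.symm⟩
    · exact ⟨∅, fun h => absurd h hA⟩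
  choose s hs using hf'
  -- The fibres of the membership pattern `c` are disjoint, so their counts are independent Poisson
  -- variables; the count of each `A` in `T` is a sum of them.
  let c : S → (T → Bool) := fun z A => decide (z ∈ A.1.1)
  have hcm : ∀ a, MeasurableSet (c ⁻¹' {a}) := fun a => by
    have : c ⁻¹' {a} = ⋂ A : T, {z | decide (z ∈ A.1.1) = a A} := by
      ext z; simp [c, funext_iff]
    rw [this]
    refine MeasurableSet.iInter fun A => ?_
    cases a A
    · convert A.1.2.compl using 1
      ext z; simp
    · convert A.1.2 using 1
      ext z; simp
  have hcd : Pairwise (Function.onFun Disjoint fun a => c ⁻¹' {a}) := fun a b hab =>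
    Disjoint.preimage _ (by simpa using hab)
  have hmap : ∀ {Q : Measure (Config S)}, IsPoissonLaw ν Q →
      Q.map (fun x a => count (c ⁻¹' {a}) x) =
        Measure.pi fun a => poissonMeasure (ν (c ⁻¹' {a})).toNNReal := fun {Q} hQ => by
    have := hQ.isProbabilityMeasure
    rw [(iIndepFun_iff_map_fun_eq_pi_map fun a => (measurable_count (hcm a)).aemeasurable).1
      (hQ.iIndepFun_fintype hcm hcd)]
    simp_rw [hQ.map_count _ (hcm _)]
  let B : Set ((T → Bool) → ℕ) := {n | ∀ A : T, ∑ a with a A = true, n a ∈ s A}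
  have hset : ⋂ A ∈ T, f A = (fun x a => count (c ⁻¹' {a}) x) ⁻¹' B := by
    have hsum : ∀ (A : T) (x : Config S),
        ∑ a : T → Bool with a A = true, count (c ⁻¹' {a}) x = count A.1.1 x := fun A x => by
      rw [count_eq_card_filter A.1.1 x, Finset.card_eq_sum_card_fiberwise
        (t := Finset.univ.filter fun a : T → Bool => a A = true) (f := c)]
      · refine Finset.sum_congr rfl fun a ha => ?_
        rw [count_eq_card_filter, Finset.filter_filter]
        congr 1
        refine Finset.filter_congr fun z _ => ?_
        have := (Finset.mem_filter.1 ha).2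
        constructor
        · intro h
          have h' : c z = a := h
          refine ⟨?_, h'⟩
          rw [← h'] at this
          simpa [c] using this
        · exact fun h => h.2
      · intro z hz
        simp only [Finset.coe_filter, Set.mem_ofPred_eq] at hz
        simpa [c] using hz.2
    ext x
    simp only [Set.mem_iInter, B, Set.mem_preimage, Set.mem_ofPred_eq, hsum]
    exact ⟨fun h A => by simpa [hs A.1 A.2] using h A.1 A.2,
      fun h A hA => by simpa [hs A hA] using h ⟨A, hA⟩⟩
  have hBm : MeasurableSet B := MeasurableSet.of_discrete
  have hm : Measurable (fun (x : Config S) (a : T → Bool) => count (c ⁻¹' {a}) x) :=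
    measurable_pi_lambda _ fun a => measurable_count (hcm a)
  rw [hset, ← Measure.map_apply hm hBm, ← Measure.map_apply hm hBm, hmap hL, hmap hL']

lemma ae_count_eq_zero (hL : IsPoissonLaw ν L) {A : Set S} (hA : MeasurableSet A)
    (h0 : ν A = 0) : ∀ᵐ x ∂L, count A x = 0 := by
  have : L.map (count A) {0}ᶜ = 0 := by
    rw [hL.map_count A hA, prob_compl_eq_zero_iff (by measurability), poissonMeasure_singleton]
    simp [h0]
  rw [Measure.map_apply (measurable_count hA) (by measurability)] at this
  exact this

/-- Admissibility constrains the energy only on the support of `ν`; this makes the resulting bound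
hold almost surely. -/
lemma ae_mem_support [TopologicalSpace S] [HereditarilyLindelofSpace S] [OpensMeasurableSpace S]
    (hL : IsPoissonLaw ν L) : ∀ᵐ x ∂L, ∀ z ∈ x.points, z ∈ ν.support := by
  filter_upwards [hL.ae_count_eq_zero Measure.isOpen_compl_support.measurableSet
    Measure.measure_compl_support] with x hx z hz
  simpa using count_eq_zero_iff.1 hx z hz

end IsPoissonLaw

/-! ### The partition of space by small balls about the points of a configuration. -/

section Cells

variable {S : Type*} [MetricSpace S]

/-- The closed balls of radius `δ` about the points of `x`, and the complement of their union. -/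
def cells (x : Config S) (δ : ℝ) : Option x.points → Set S
  | none => (thick x δ)ᶜ
  | some w => Metric.closedBall (w : S) δ

lemma measurableSet_cells [MeasurableSpace S] [BorelSpace S] (x : Config S) (δ : ℝ)
    (o : Option x.points) : MeasurableSet (cells x δ o) :=
  match o with
  | none => (isClosed_thick x δ).measurableSet.compl
  | some _ => Metric.isClosed_closedBall.measurableSet

lemma eventually_pairwise_cells (x : Config S) :
    ∀ᶠ δ in 𝓝[>] (0 : ℝ), Pairwise (Function.onFun Disjoint (cells x δ)) := by
  have h : ∀ᶠ δ in 𝓝[>] (0 : ℝ), ∀ v w : x.points, v ≠ w → δ + δ < dist (v : S) w := by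
    refine eventually_all.2 fun v => eventually_all.2 fun w => ?_
    by_cases hvw : v = w
    · simp [hvw]
    have hpos : 0 < dist (v : S) w := dist_pos.2 fun h => hvw (Subtype.ext h)
    filter_upwards [Ioo_mem_nhdsGT (half_pos hpos)] with δ hδ _
    linarith [hδ.2]
  filter_upwards [h] with δ hδ
  have hn : ∀ w, Disjoint (cells x δ none) (cells x δ (some w)) := fun w =>
    (Set.disjoint_compl_left_iff_subset.2
      (Set.subset_iUnion (fun w : x.points => Metric.closedBall (w : S) δ) w))
  rintro (_ | v) (_ | w) hvw
  · exact absurd rfl hvw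
  · exact hn w
  · exact (hn v).symm
  · exact Metric.closedBall_disjoint_closedBall (hδ v w fun h => hvw (by rw [h]))

lemma exists_cell (x : Config S) (δ : ℝ) (z : S) : ∃ o, z ∈ cells x δ o := by
  by_cases hz : z ∈ thick x δ
  · obtain ⟨w, hw⟩ := Set.mem_iUnion.1 hz
    exact ⟨some w, hw⟩
  · exact ⟨none, hz⟩

lemma sum_comp_eq_sum_cells {x : Config S} {δ : ℝ}
    (hd : Pairwise (Function.onFun Disjoint (cells x δ))) {c : S → Option x.points}
    (hc : ∀ z, z ∈ cells x δ (c z)) (y : Config S) (h : Option x.points → ℝ) :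
    ∑ z ∈ y.points, h (c z) = ∑ o, (count (cells x δ o) y : ℝ) * h o := by
  have : ∀ o, c ⁻¹' {o} = cells x δ o := fun o => by
    ext z
    refine ⟨fun h => ?_, fun h => ?_⟩
    · have h' : c z = o := h
      exact h' ▸ hc z
    · by_contra hne
      exact Set.disjoint_left.1 (hd hne) (hc z) h
  rw [sum_comp_eq_sum_count y c Finset.univ (by simp) h]
  simp_rw [this]

end Cells

/-! ### Admissibility implies stability. -/

/-- Since `t! ≤ t ^ t`, the term is at least the `t`-th power of `exp (g * t) / t ^ m * D`, which is
eventually at least `2`. -/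
lemma tendsto_exp_sq_mul_pow_div_factorial_pow {g D : ℝ} (hg : 0 < g) (hD : 0 < D) (m : ℕ) :
    Tendsto (fun t : ℕ => Real.exp (g * t ^ 2) * D ^ t / (t.factorial : ℝ) ^ m) atTop atTop := by
  have h1 : Tendsto (fun t : ℕ => Real.exp (g * t) / (t : ℝ) ^ m) atTop atTop := by
    have h := ((tendsto_exp_mul_div_rpow_atTop (m : ℝ) g hg).comp
      tendsto_natCast_atTop_atTop)
    simpa [Function.comp_def, Real.rpow_natCast] using h
  have h2 : Tendsto (fun t : ℕ => Real.exp (g * t) / (t : ℝ) ^ m * D) atTop atTop :=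
    h1.atTop_mul_const hD
  refine tendsto_atTop_mono' _ ?_ (tendsto_pow_atTop_atTop_of_one_lt (one_lt_two (α := ℝ)))
  filter_upwards [h2.eventually_ge_atTop 2, eventually_ge_atTop 1] with t ht ht1
  have ht0 : (0 : ℝ) < t := by exact_mod_cast ht1
  calc (2 : ℝ) ^ t ≤ (Real.exp (g * t) / (t : ℝ) ^ m * D) ^ t := by gcongr
    _ = Real.exp (g * t ^ 2) * D ^ t / ((t : ℝ) ^ t) ^ m := by
        rw [mul_pow, div_pow, ← Real.exp_nat_mul, ← pow_mul, ← pow_mul, mul_comm m t]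
        ring_nf
    _ ≤ _ := by
        gcongr
        exact_mod_cast Nat.factorial_le_pow t

section Stability

variable {S : Type*} [MetricSpace S] [CompactSpace S] [MeasurableSpace S] [BorelSpace S]
  {ν : Measure S} [IsFiniteMeasure ν] {L : Measure (Config S)} {φ : S → ℝ} {ψ : ℝ → ℝ}

/-- An admissible pair interaction is copositive on the support of the mean measure. -/
lemma sum_pairs_nonneg (hL : IsPoissonLaw ν L) (hφ : Continuous φ)
    (hψ : ContinuousOn ψ (Set.Ici 0))
    (hint : ∫⁻ x, ENNReal.ofReal (Real.exp (-energy φ ψ x)) ∂L ≠ ∞)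
    {x : Config S} (hx : ∀ z ∈ x.points, z ∈ ν.support) :
    0 ≤ ∑ z ∈ x.points, ∑ w ∈ x.points, ψ (dist z w) := by
  by_contra! hT
  set T := ∑ z ∈ x.points, ∑ w ∈ x.points, ψ (dist z w) with hTdef
  set m := x.points.card with hm
  have hm0 : (0 : ℝ) < m := by
    rw [Nat.cast_pos, hm, Finset.card_pos, Finset.nonempty_iff_ne_empty]
    intro h0
    simp [hTdef, h0] at hT
  obtain ⟨K, hK⟩ := isCompact_univ.exists_bound_of_continuousOn hφ.continuousOn
  -- An error `γ` in each of the `m ^ 2` pairs raises the double sum from `T` to `T / 2`, still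
  -- negative.
  set γ := -T / 2 / m ^ 2 with hγdef
  have hγ : 0 < γ := by have : 0 < -T := by linarith
                        positivity
  have hcont : Continuous fun p : S × S => ψ (dist p.1 p.2) :=
    hψ.comp_continuous continuous_dist fun p => dist_nonneg
  have hnear : ∀ᶠ δ in 𝓝[>] (0 : ℝ), ∀ v w : x.points, ∀ a ∈ Metric.closedBall (v : S) δ,
      ∀ b ∈ Metric.closedBall (w : S) δ, ψ (dist a b) ≤ ψ (dist (v : S) w) + γ := by
    refine eventually_all.2 fun v => eventually_all.2 fun w => ?_
    obtain ⟨r, hr, h⟩ := Metric.continuousAt_iff.1 (hcont.continuousAt (x := ((v : S), (w : S)))) γ hγ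
    filter_upwards [Ioo_mem_nhdsGT hr] with δ hδ a ha b hb
    have := h (x := (a, b)) (max_lt ((Metric.mem_closedBall.1 ha).trans_lt hδ.2)
      ((Metric.mem_closedBall.1 hb).trans_lt hδ.2))
    rw [Real.dist_eq] at this
    linarith [(abs_lt.1 this).2]
  obtain ⟨δ, hnear, hd, hδ⟩ := (hnear.and ((eventually_pairwise_cells x).and
    self_mem_nhdsWithin)).exists
  choose c hc using exists_cell x δ
  set lam : Option x.points → ℝ := fun o => (ν (cells x δ o)).toNNReal with hlam
  -- Balls about points of the support have positive mass; this is the only use of `hx`.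
  have hlampos : ∀ w : x.points, 0 < lam (some w) := fun w => by
    have h : 0 < ν (cells x δ (some w)) :=
      Measure.mem_support_iff_forall _ |>.1 (hx w w.2) _ (Metric.closedBall_mem_nhds _ hδ)
    exact_mod_cast ENNReal.toNNReal_pos h.ne' (measure_ne_top _ _)
  set C := m * (K + |ψ 0| / 2) with hC
  set g := -T / 4 with hg
  -- Exactly `t` points in each ball and none elsewhere. There the pair sum is at most `t ^ 2 * (T /
  -- 2)`, halved in the energy to give `g`; `C` absorbs the one-point terms and the diagonal, linear
  -- in `t`.
  let E : ℕ → Set (Config S) := fun t =>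
    {y | ∀ o, count (cells x δ o) y = (o.elim 0 fun _ => t : ℕ)}
  have hE : ∀ t, ∀ y ∈ E t, g * t ^ 2 - C * t ≤ -energy φ ψ y := by
    intro t y hy
    have hsum : ∀ h : Option x.points → ℝ,
        ∑ z ∈ y.points, h (c z) = t * ∑ w, h (some w) := fun h => by
      rw [sum_comp_eq_sum_cells hd hc y h, Fintype.sum_option, Finset.mul_sum]
      simp [hy _]
    have hcard : (y.points.card : ℝ) = t * m := by
      have := hsum fun _ => 1
      simpa [hm] using this
    have hsome : ∀ z ∈ y.points, ∃ w, c z = some w := by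
      intro z hz
      have h0 := count_eq_zero_iff.1 (hy none) z hz
      rcases hcz : c z with _ | w
      · exact absurd (hcz ▸ hc z) h0
      · exact ⟨w, rfl⟩
    let H : Option x.points → Option x.points → ℝ := fun o o' =>
      o.elim 0 fun v => o'.elim 0 fun w => ψ (dist (v : S) w) + γ
    have hpair : ∑ z ∈ y.points, ∑ z' ∈ y.points, ψ (dist z z') ≤ t ^ 2 * (T / 2) := by
      calc ∑ z ∈ y.points, ∑ z' ∈ y.points, ψ (dist z z')
          ≤ ∑ z ∈ y.points, ∑ z' ∈ y.points, H (c z) (c z') := by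
            refine Finset.sum_le_sum fun z hz => Finset.sum_le_sum fun z' hz' => ?_
            obtain ⟨v, hv⟩ := hsome z hz
            obtain ⟨w, hw⟩ := hsome z' hz'
            have h1 := hc z
            have h2 := hc z'
            rw [hv] at h1 ⊢
            rw [hw] at h2 ⊢
            exact hnear v w z h1 z' h2
        _ = t * ∑ v : x.points, (t * ∑ w : x.points, (ψ (dist (v : S) w) + γ)) := by
            refine (hsum fun o => ∑ z' ∈ y.points, H o (c z')).trans ?_
            congr 1
            exact Finset.sum_congr rfl fun v _ => hsum (H (some v))
        _ = t ^ 2 * (T / 2) := by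
            rw [← Finset.mul_sum]
            have h1 : ∑ v : x.points, ∑ w : x.points, (ψ (dist (v : S) w) + γ) = T + m ^ 2 * γ := by
              simp only [Finset.sum_add_distrib, Finset.sum_const, Finset.card_univ,
                Fintype.card_coe, nsmul_eq_mul, ← hm]
              rw [hTdef, ← Finset.sum_coe_sort x.points]
              simp_rw [← Finset.sum_coe_sort x.points]
              ring
            rw [h1, hγdef]
            field_simp
            ring
    have hone : ∑ z ∈ y.points, φ z ≤ t * m * K := by
      rw [← hcard, ← nsmul_eq_mul]
      exact Finset.sum_le_card_nsmul _ _ _ fun z _ => (le_abs_self _).trans (hK z trivial)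
    have habs : -(t * m * ψ 0) ≤ t * m * |ψ 0| := by
      rw [← mul_neg]
      exact mul_le_mul_of_nonneg_left (neg_le_abs _) (by positivity)
    rw [energy_eq, hcard, hC, hg]
    nlinarith
  have hLE : ∀ t : ℕ, ENNReal.ofReal (Real.exp (-lam none) * (∏ w, Real.exp (-lam (some w))) *
      (∏ w, lam (some w)) ^ t / (t.factorial : ℝ) ^ m) = L (E t) := by
    intro t
    rw [hL.measure_count_eq (measurableSet_cells x δ) hd, ← ENNReal.ofReal_prod_of_nonneg
      (fun o _ => by positivity), Fintype.prod_option]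
    congr 1
    simp [Finset.prod_div_distrib, Finset.prod_mul_distrib, Finset.prod_pow, hm, hlam]
    ring
  have hle : ∀ t : ℕ, ENNReal.ofReal (Real.exp (-lam none) * (∏ w, Real.exp (-lam (some w))) *
      (Real.exp (g * t ^ 2) * (Real.exp (-C) * ∏ w, lam (some w)) ^ t / (t.factorial : ℝ) ^ m)) ≤
      ∫⁻ x, ENNReal.ofReal (Real.exp (-energy φ ψ x)) ∂L := by
    intro t
    have hmeas : Measurable fun x => ENNReal.ofReal (Real.exp (-energy φ ψ x)) :=
      (Real.measurable_exp.comp (measurable_energy hφ hψ).neg).ennreal_ofReal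
    -- Markov's inequality, with the bound `hE` on `E t`.
    refine le_trans ?_ (mul_meas_ge_le_lintegral hmeas
      (ENNReal.ofReal (Real.exp (g * t ^ 2 - C * t))))
    refine le_trans ?_ (mul_le_mul_right (measure_mono (s := E t) fun y hy =>
      ENNReal.ofReal_le_ofReal (Real.exp_le_exp.2 (hE t y hy))) _)
    rw [← hLE, ← ENNReal.ofReal_mul (Real.exp_nonneg _)]
    refine ENNReal.ofReal_le_ofReal (le_of_eq ?_)
    rw [sub_eq_add_neg, Real.exp_add, mul_pow, ← Real.exp_nat_mul]
    ring_nf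
  have hlim := ENNReal.tendsto_ofReal_atTop.comp
    ((tendsto_exp_sq_mul_pow_div_factorial_pow (g := g) (by rw [hg]; linarith)
      (mul_pos (Real.exp_pos (-C)) (Finset.prod_pos fun w (_ : w ∈ Finset.univ) => hlampos w))
      m).const_mul_atTop (mul_pos (Real.exp_pos (-lam none))
      (Finset.prod_pos fun w (_ : w ∈ Finset.univ) => Real.exp_pos (-lam (some w)))))
  exact hint (top_le_iff.1 (le_of_tendsto' hlim hle))

/-- Once the nonnegative double sum is dropped, only the one-point terms and the diagonal remain,
and both are linear in the number of points. -/
lemma exists_exp_neg_energy_le (hL : IsPoissonLaw ν L) (hφ : Continuous φ)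
    (hψ : ContinuousOn ψ (Set.Ici 0))
    (hint : ∫⁻ x, ENNReal.ofReal (Real.exp (-energy φ ψ x)) ∂L ≠ ∞) :
    ∃ C : ℝ, ∀ x : Config S, (∀ z ∈ x.points, z ∈ ν.support) →
      -energy φ ψ x ≤ C * x.points.card := by
  obtain ⟨K, hK⟩ := isCompact_univ.exists_bound_of_continuousOn hφ.continuousOn
  refine ⟨K + ψ 0 / 2, fun x hx => ?_⟩
  have h1 := sum_pairs_nonneg hL hφ hψ hint hx
  have h2 : ∑ z ∈ x.points, -φ z ≤ x.points.card * K := by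
    rw [← nsmul_eq_mul]
    exact Finset.sum_le_card_nsmul _ _ _ fun z _ => (neg_le_abs _).trans (hK z trivial)
  rw [Finset.sum_neg_distrib] at h2
  rw [energy_eq]
  linarith

end Stability

/-! ### Poisson estimates on small Hausdorff balls. -/

section Asymptotics

lemma measurable_card {S : Type*} [MeasurableSpace S] :
    Measurable fun x : Config S => x.points.card := by
  simp_rw [← count_univ]
  exact measurable_count MeasurableSet.univ

variable {S : Type*} [MetricSpace S]

/-- The configurations in the Hausdorff ball of radius `δ` about `x` with as many points as `x`. -/
def equinumerousBall (x : Config S) (δ : ℝ) : Set (Config S) :=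
  {y ∈ hausdorffBall x δ | y.points.card = x.points.card}

lemma equinumerousBall_mono (x : Config S) {δ ε : ℝ} (h : δ ≤ ε) :
    equinumerousBall x δ ⊆ equinumerousBall x ε :=
  fun _ hy => ⟨hausdorffBall_mono x h hy.1, hy.2⟩

lemma measurableSet_equinumerousBall [MeasurableSpace S] [BorelSpace S] (x : Config S) {δ : ℝ}
    (hδ : 0 ≤ δ) : MeasurableSet (equinumerousBall x δ) :=
  (measurableSet_hausdorffBall x hδ).inter (measurable_card (measurableSet_singleton _))

lemma card_eq_sum_cells {x : Config S} {δ : ℝ}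
    (hd : Pairwise (Function.onFun Disjoint (cells x δ))) (y : Config S) :
    y.points.card = ∑ o, count (cells x δ o) y := by
  choose c hc using exists_cell x δ
  have := sum_comp_eq_sum_cells hd hc y fun _ => 1
  simp only [Finset.sum_const, nsmul_eq_mul, mul_one] at this
  exact_mod_cast this

lemma card_eq_of_mem_hausdorffBall {x y : Config S} {δ : ℝ} (hδ : 0 ≤ δ)
    (hd : Pairwise (Function.onFun Disjoint (cells x δ))) (hy : y ∈ hausdorffBall x δ) :
    y.points.card = ∑ w : x.points, count (Metric.closedBall (w : S) δ) y := by
  rw [card_eq_sum_cells hd, Fintype.sum_option]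
  simp only [cells, ((mem_hausdorffBall_iff_count hδ).1 hy).1, zero_add]

variable [MeasurableSpace S] [BorelSpace S] {ν : Measure S} [IsFiniteMeasure ν]
  {L : Measure (Config S)}

/-- On the ball the weight factors over the cells, so independence reduces the integral to one
Poisson variable per point of `x`; the condition that no point lies outside is dropped. -/
lemma setLIntegral_hausdorffBall_pow_card_le (hL : IsPoissonLaw ν L) {x : Config S} {δ : ℝ}
    (hδ : 0 ≤ δ) (hd : Pairwise (Function.onFun Disjoint (cells x δ))) {D : ℝ} (hD : 0 ≤ D) :
    ∫⁻ y in hausdorffBall x δ, ENNReal.ofReal (D ^ y.points.card) ∂L ≤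
      ENNReal.ofReal (D ^ x.points.card *
        Real.exp (D * ∑ w : x.points, ν.real (Metric.closedBall (w : S) δ))) *
        ∏ w : x.points, ν (Metric.closedBall (w : S) δ) := by
  let g : Option x.points → ℕ → ℝ≥0∞ := fun o k =>
    o.elim 1 fun _ => if 1 ≤ k then ENNReal.ofReal (D ^ k) else 0
  calc ∫⁻ y in hausdorffBall x δ, ENNReal.ofReal (D ^ y.points.card) ∂L
      ≤ ∫⁻ y in hausdorffBall x δ, ∏ o, g o (count (cells x δ o) y) ∂L := by
        refine setLIntegral_mono' (measurableSet_hausdorffBall x hδ) fun y hy => ?_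
        rw [card_eq_of_mem_hausdorffBall hδ hd hy, ← Finset.prod_pow_eq_pow_sum,
          ENNReal.ofReal_prod_of_nonneg fun _ _ => by positivity, Fintype.prod_option]
        simp [g, cells, ((mem_hausdorffBall_iff_count hδ).1 hy).2]
    _ ≤ ∫⁻ y, ∏ o, g o (count (cells x δ o) y) ∂L := setLIntegral_le_lintegral _ _
    _ = ∏ o, ∫⁻ k, g o k ∂poissonMeasure (ν (cells x δ o)).toNNReal :=
        hL.lintegral_prod_count (measurableSet_cells x δ) hd g
    _ ≤ ∏ w : x.points, ENNReal.ofReal (D * Real.exp (D * ν.real (Metric.closedBall (w : S) δ))) *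
          ν (Metric.closedBall (w : S) δ) := by
        rw [Fintype.prod_option]
        simp only [g, Option.elim, lintegral_one, measure_univ, one_mul]
        refine Finset.prod_le_prod' fun w _ => ?_
        refine (lintegral_pow_poissonMeasure_le _ hD).trans (le_of_eq ?_)
        rw [ENNReal.coe_toNNReal (measure_ne_top _ _)]
        rfl
    _ = _ := by
        rw [Finset.prod_mul_distrib, ← ENNReal.ofReal_prod_of_nonneg fun _ _ => by positivity,
          Finset.prod_mul_distrib, ← Real.exp_sum, ← Finset.mul_sum]
        simp

/-- Only the event of one point per ball and none elsewhere is counted. The product of masses is the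
one in the upper bound, so the two compare with no lower bound on `ν`; the exponent is the number of
cells. -/
lemma le_measure_equinumerousBall (hL : IsPoissonLaw ν L) {x : Config S} {δ : ℝ}
    (hδ : 0 ≤ δ) (hd : Pairwise (Function.onFun Disjoint (cells x δ))) :
    ENNReal.ofReal (Real.exp (-ν.real Set.univ) ^ (x.points.card + 1)) *
      ∏ w : x.points, ν (Metric.closedBall (w : S) δ) ≤ L (equinumerousBall x δ) := by
  have hsub : {y : Config S | ∀ o, count (cells x δ o) y = (o.elim 0 fun _ => 1 : ℕ)} ⊆
      equinumerousBall x δ := fun y hy => by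
    have h1 : ∀ w : x.points, count (Metric.closedBall (w : S) δ) y = 1 := fun w => hy (some w)
    have hb : y ∈ hausdorffBall x δ :=
      (mem_hausdorffBall_iff_count hδ).2 ⟨hy none, fun w => (h1 w).ge⟩
    refine ⟨hb, ?_⟩
    rw [card_eq_of_mem_hausdorffBall hδ hd hb]
    simp [h1]
  refine le_trans ?_ (measure_mono hsub)
  rw [hL.measure_count_eq (measurableSet_cells x δ) hd]
  have hexp : ∀ o, Real.exp (-ν.real Set.univ) ≤ Real.exp (-(ν (cells x δ o)).toNNReal) :=
    fun o => Real.exp_le_exp.2 (neg_le_neg (measureReal_mono (Set.subset_univ _)))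
  calc _ = ∏ o : Option x.points, ENNReal.ofReal (Real.exp (-ν.real Set.univ)) *
        (o.elim 1 fun w => ν (Metric.closedBall (w : S) δ) : ℝ≥0∞) := by
        rw [Finset.prod_mul_distrib, Fintype.prod_option (fun o : Option x.points => o.elim _ _)]
        simp [ENNReal.ofReal_pow (Real.exp_nonneg _)]
    _ ≤ _ := by
        refine Finset.prod_le_prod' fun o _ => ?_
        rcases o with _ | w
        · simpa using ENNReal.ofReal_le_ofReal (hexp none)
        · simp only [Option.elim, pow_one, Nat.factorial_one, Nat.cast_one, div_one]
          rw [ENNReal.ofReal_mul (Real.exp_nonneg _), ENNReal.ofReal_coe_nnreal,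
            ENNReal.coe_toNNReal (measure_ne_top _ _)]
          exact mul_le_mul_left (ENNReal.ofReal_le_ofReal (hexp (some w))) _

/-- The absence of atoms enters the argument here, through continuity from above. -/
lemma tendsto_sum_measureReal_closedBall (hν : ∀ ζ : S, ν {ζ} = 0) (x : Config S) :
    Tendsto (fun δ => ∑ w : x.points, ν.real (Metric.closedBall (w : S) δ)) (𝓝[>] 0) (𝓝 0) := by
  suffices h : ∀ w : x.points,
      Tendsto (fun δ => ν.real (Metric.closedBall (w : S) δ)) (𝓝[>] 0) (𝓝 0) by
    simpa using tendsto_finsetSum Finset.univ fun w _ => h w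
  intro w
  have h := (tendsto_measure_cthickening_of_isClosed (μ := ν) (s := {(w : S)})
    ⟨1, one_pos, measure_ne_top _ _⟩ isClosed_singleton).mono_left
    (nhdsWithin_le_nhds (s := Set.Ioi (0 : ℝ)))
  rw [hν] at h
  have h2 := (ENNReal.tendsto_toReal ENNReal.zero_ne_top).comp h
  refine (h2.congr' ?_)
  filter_upwards [self_mem_nhdsWithin] with δ hδ
  simp [Metric.cthickening_singleton _ (le_of_lt (Set.mem_Ioi.1 hδ)), Measure.real]

/-- Near `x`, the configurations with more points than `x` are negligible, even when they are
weighted by an exponential of the number of their points. -/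
lemma eventually_setLIntegral_pow_card_le (hL : IsPoissonLaw ν L) (hν : ∀ ζ : S, ν {ζ} = 0)
    (x : Config S) {C : ℝ} (hC : 0 ≤ C) {η : ℝ} (hη : 0 < η) :
    ∀ᶠ δ in 𝓝[>] (0 : ℝ),
      ∫⁻ y in hausdorffBall x δ \ equinumerousBall x δ, ENNReal.ofReal (C ^ y.points.card) ∂L ≤
        ENNReal.ofReal η * L (equinumerousBall x δ) := by
  set n := x.points.card with hn
  set a := Real.exp (-ν.real Set.univ) ^ (n + 1) with ha
  have ha0 : 0 < a := by positivity
  -- The `2` pays for the exponential factor, at most `2` for small `δ`; the `+ 1` keeps the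
  -- denominator positive.
  set ε := min 1 (η * a / (2 * (C ^ n + 1))) with hε
  have hε0 : 0 < ε := lt_min one_pos (by positivity)
  have hε1 : ε ≤ 1 := min_le_left _ _
  have hε2 : ε * C ^ n * 2 ≤ η * a := by
    have h1 : ε ≤ η * a / (2 * (C ^ n + 1)) := min_le_right _ _
    rw [le_div_iff₀ (by positivity)] at h1
    nlinarith
  have hexp : Tendsto (fun δ => Real.exp (C / ε * ∑ w : x.points,
      ν.real (Metric.closedBall (w : S) δ))) (𝓝[>] 0) (𝓝 1) := by
    have := (Real.continuous_exp.tendsto (C / ε * 0)).comp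
      ((tendsto_sum_measureReal_closedBall hν x).const_mul (C / ε))
    rwa [mul_zero, Real.exp_zero] at this
  filter_upwards [eventually_pairwise_cells x, self_mem_nhdsWithin,
    hexp.eventually_le_const one_lt_two] with δ hd hδ hδ2
  have hδ0 : (0 : ℝ) ≤ δ := le_of_lt hδ
  -- With at least `n + 1` points, replacing the weight base `C` by `C / ε` gains `ε ^ (n + 1)`,
  -- while the integral bound loses only `ε ^ n`.
  have hpt : ∀ y ∈ hausdorffBall x δ \ equinumerousBall x δ,
      ENNReal.ofReal (C ^ y.points.card) ≤
        ENNReal.ofReal (ε ^ (n + 1)) * ENNReal.ofReal ((C / ε) ^ y.points.card) := by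
    rintro y ⟨hy, hy'⟩
    have hle : n ≤ y.points.card := by
      rw [card_eq_of_mem_hausdorffBall hδ0 hd hy, hn, ← Fintype.card_coe, ← Finset.card_univ,
        Finset.card_eq_sum_ones]
      exact Finset.sum_le_sum fun w _ => ((mem_hausdorffBall_iff_count hδ0).1 hy).2 w
    have hlt : n + 1 ≤ y.points.card := lt_of_le_of_ne hle fun h => hy' ⟨hy, h.symm⟩
    rw [← ENNReal.ofReal_mul (by positivity)]
    refine ENNReal.ofReal_le_ofReal ?_
    calc C ^ y.points.card = ε ^ y.points.card * (C / ε) ^ y.points.card := by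
          rw [← mul_pow, mul_div_cancel₀ _ hε0.ne']
      _ ≤ _ := mul_le_mul_of_nonneg_right (pow_le_pow_of_le_one hε0.le hε1 hlt) (by positivity)
  calc ∫⁻ y in hausdorffBall x δ \ equinumerousBall x δ, ENNReal.ofReal (C ^ y.points.card) ∂L
      ≤ ∫⁻ y in hausdorffBall x δ \ equinumerousBall x δ,
          ENNReal.ofReal (ε ^ (n + 1)) * ENNReal.ofReal ((C / ε) ^ y.points.card) ∂L :=
        setLIntegral_mono' ((measurableSet_hausdorffBall x hδ0).diff
          (measurableSet_equinumerousBall x hδ0)) hpt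
    _ ≤ ∫⁻ y in hausdorffBall x δ,
          ENNReal.ofReal (ε ^ (n + 1)) * ENNReal.ofReal ((C / ε) ^ y.points.card) ∂L :=
        lintegral_mono_set Set.sdiff_subset
    _ = ENNReal.ofReal (ε ^ (n + 1)) *
          ∫⁻ y in hausdorffBall x δ, ENNReal.ofReal ((C / ε) ^ y.points.card) ∂L :=
        lintegral_const_mul' _ _ ENNReal.ofReal_ne_top
    _ ≤ ENNReal.ofReal (ε ^ (n + 1)) * (ENNReal.ofReal ((C / ε) ^ n * 2) *
          ∏ w : x.points, ν (Metric.closedBall (w : S) δ)) := by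
        gcongr
        refine (setLIntegral_hausdorffBall_pow_card_le hL hδ0 hd (by positivity)).trans ?_
        gcongr
    _ ≤ ENNReal.ofReal η * (ENNReal.ofReal a *
          ∏ w : x.points, ν (Metric.closedBall (w : S) δ)) := by
        rw [← mul_assoc, ← mul_assoc, ← ENNReal.ofReal_mul (by positivity),
          ← ENNReal.ofReal_mul hη.le]
        refine mul_le_mul_left (ENNReal.ofReal_le_ofReal ?_) _
        calc ε ^ (n + 1) * ((C / ε) ^ n * 2) = ε * (ε * (C / ε)) ^ n * 2 := by ring
          _ ≤ η * a := by rwa [mul_div_cancel₀ _ hε0.ne']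
    _ ≤ _ := by
        gcongr
        exact le_measure_equinumerousBall hL hδ0 hd

end Asymptotics

/-! ### Continuity of the energy at a fixed number of points. -/

section Near

variable {S : Type*} [MetricSpace S]

/-- The filter of the Hausdorff neighbourhoods of `x` among the configurations with as many points
as `x`. -/
def near (x : Config S) : Filter (Config S) :=
  ⨅ δ ∈ Set.Ioi (0 : ℝ), 𝓟 (equinumerousBall x δ)

lemma hasBasis_near (x : Config S) :
    (near x).HasBasis (fun δ : ℝ => 0 < δ) (equinumerousBall x) :=
  hasBasis_biInf_principal (fun δ hδ ε hε => ⟨min δ ε, Set.mem_Ioi.2 (lt_min hδ hε),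
    equinumerousBall_mono x (min_le_left _ _), equinumerousBall_mono x (min_le_right _ _)⟩)
    ⟨1, Set.mem_Ioi.2 one_pos⟩

lemma eventually_forall_of_eventually_near {x : Config S} {p : Config S → Prop}
    (h : ∀ᶠ y in near x, p y) : ∀ᶠ δ in 𝓝[>] (0 : ℝ), ∀ y ∈ equinumerousBall x δ, p y := by
  obtain ⟨ε, hε, h⟩ := (hasBasis_near x).eventually_iff.1 h
  filter_upwards [Ioo_mem_nhdsGT hε] with δ hδ y hy
  exact h (equinumerousBall_mono x hδ.2.le hy)

/-- The energy is a continuous function `E` of points labelled by those of `x`, and a nearby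
configuration of equal size can be so labelled: its points within `δ` of distinct points of `x` are
distinct. -/
lemma tendsto_energy_near {φ : S → ℝ} {ψ : ℝ → ℝ} (hφ : Continuous φ)
    (hψ : ContinuousOn ψ (Set.Ici 0)) (x : Config S) :
    Tendsto (energy φ ψ) (near x) (𝓝 (energy φ ψ x)) := by
  let E : (x.points → S) → ℝ := fun s => ∑ w, φ (s w) + (1 / 2) *
    (∑ v, ∑ w, ψ (dist (s v) (s w)) - x.points.card * ψ 0)
  have hcont : Continuous fun p : S × S => ψ (dist p.1 p.2) :=
    hψ.comp_continuous continuous_dist fun p => dist_nonneg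
  have hE : Continuous E := by
    have h2 : ∀ v w : x.points, Continuous fun s : x.points → S => ψ (dist (s v) (s w)) :=
      fun v w => hcont.comp
        (g := fun p : S × S => ψ (dist p.1 p.2)) (f := fun s : x.points → S => (s v, s w)) (by fun_prop)
    exact (continuous_finsetSum _ fun w _ => hφ.comp (continuous_apply w)).add
      (continuous_const.mul ((continuous_finsetSum _ fun v _ => continuous_finsetSum _ fun w _ =>
        h2 v w).sub continuous_const))
  have hEy : ∀ (y : Config S) (s : x.points → y.points), Function.Bijective s →
      E (fun w => s w) = energy φ ψ y := fun y s hs => by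
    have hsum : ∀ h : S → ℝ, ∑ w, h (s w) = ∑ z ∈ y.points, h z := fun h => by
      rw [← Finset.sum_coe_sort y.points]
      exact hs.sum_comp fun z : y.points => h z
    have hcard : x.points.card = y.points.card := by
      simpa using Fintype.card_of_bijective hs
    simp only [E, energy_eq, hsum φ, hcard]
    rw [hsum fun z => ∑ w, ψ (dist z (s w))]
    simp_rw [fun z => hsum fun w => ψ (dist z w)]
  rw [Metric.tendsto_nhds]
  intro ε hε
  obtain ⟨r, hr, hr'⟩ := Metric.continuousAt_iff.1 (hE.continuousAt (x := fun w : x.points => (w : S))) ε hε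
  obtain ⟨δ, hd, hδ⟩ := ((eventually_pairwise_cells x).and (Ioo_mem_nhdsGT hr)).exists
  refine (hasBasis_near x).eventually_iff.2 ⟨δ, hδ.1, fun y hy => ?_⟩
  choose s hs hsd using fun w : x.points =>
    ((mem_hausdorffBall_iff hδ.1.le).1 hy.1).2 w w.2
  have hinj : Function.Injective fun w => (⟨s w, hs w⟩ : y.points) := fun v w hvw => by
    by_contra hne
    have h1 : s v = s w := congrArg Subtype.val hvw
    exact Set.disjoint_left.1 (hd (i := some v) (j := some w) (by simpa using hne))
      (Metric.mem_closedBall.2 (hsd v)) (Metric.mem_closedBall.2 (h1 ▸ hsd w))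
  have hbij := (Fintype.bijective_iff_injective_and_card
    fun w => (⟨s w, hs w⟩ : y.points)).2 ⟨hinj, by simp [hy.2]⟩
  have := hr' (x := s) (((dist_pi_le_iff hδ.1.le).2 hsd).trans_lt hδ.2)
  rwa [← hEy x id Function.bijective_id, ← hEy y _ hbij]

end Near

/-! ### Mean oscillation at a configuration. -/

section MeanOsc

variable {S : Type*} [MetricSpace S] [MeasurableSpace S] [BorelSpace S] {ν : Measure S}
  [IsFiniteMeasure ν] {L : Measure (Config S)} {F H : Config S → ℝ}

/-- The Poisson estimate passes to density `F`: the exponential bound serves on the crowded part,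
and `F ≥ F x / 2` on the rest, by continuity. -/
lemma eventually_withDensity_le (hL : IsPoissonLaw ν L) (hν : ∀ ζ : S, ν {ζ} = 0) {x : Config S}
    (hFx : 0 < F x) (hFnear : Tendsto F (near x) (𝓝 (F x)))
    {K C : ℝ} (hK : 0 ≤ K) (hC : 0 ≤ C) (hF : ∀ᵐ y ∂L, F y ≤ K * C ^ y.points.card)
    {η : ℝ} (hη : 0 < η) :
    ∀ᶠ δ in 𝓝[>] (0 : ℝ), L.withDensity (fun y => ENNReal.ofReal (F y))
        (hausdorffBall x δ \ equinumerousBall x δ) ≤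
      ENNReal.ofReal η * L.withDensity (fun y => ENNReal.ofReal (F y)) (hausdorffBall x δ) := by
  have hη' : 0 < η * (F x / 2) / (K + 1) := by positivity
  filter_upwards [eventually_setLIntegral_pow_card_le hL hν x hC hη',
    eventually_forall_of_eventually_near (hFnear.eventually_const_le (half_lt_self hFx)),
    self_mem_nhdsWithin] with δ h1 h2 hδ
  have hδ0 : (0 : ℝ) ≤ δ := le_of_lt hδ
  have hG := measurableSet_equinumerousBall x hδ0
  have hB := measurableSet_hausdorffBall x hδ0
  calc L.withDensity (fun y => ENNReal.ofReal (F y)) (hausdorffBall x δ \ equinumerousBall x δ)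
      = ∫⁻ y in hausdorffBall x δ \ equinumerousBall x δ, ENNReal.ofReal (F y) ∂L :=
        withDensity_apply _ (hB.diff hG)
    _ ≤ ∫⁻ y in hausdorffBall x δ \ equinumerousBall x δ,
          ENNReal.ofReal K * ENNReal.ofReal (C ^ y.points.card) ∂L := by
        refine lintegral_mono_ae (ae_restrict_of_ae ?_)
        filter_upwards [hF] with y hy
        rw [← ENNReal.ofReal_mul hK]
        exact ENNReal.ofReal_le_ofReal hy
    _ ≤ ENNReal.ofReal K * (ENNReal.ofReal (η * (F x / 2) / (K + 1)) *
          L (equinumerousBall x δ)) := by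
        rw [lintegral_const_mul' _ _ ENNReal.ofReal_ne_top]
        gcongr
    _ ≤ ENNReal.ofReal η * (ENNReal.ofReal (F x / 2) * L (equinumerousBall x δ)) := by
        rw [← mul_assoc, ← mul_assoc, ← ENNReal.ofReal_mul hK, ← ENNReal.ofReal_mul hη.le]
        refine mul_le_mul_left (ENNReal.ofReal_le_ofReal ?_) _
        rw [mul_div_assoc', div_le_iff₀ (by positivity)]
        have : 0 < η * (F x / 2) := by positivity
        nlinarith
    _ ≤ ENNReal.ofReal η * L.withDensity (fun y => ENNReal.ofReal (F y))
          (equinumerousBall x δ) := by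
        gcongr
        rw [withDensity_apply _ hG, ← setLIntegral_const]
        exact setLIntegral_mono' hG fun y hy => ENNReal.ofReal_le_ofReal (h2 y hy)
    _ ≤ _ := by
        gcongr
        exact fun y hy => hy.1

/-- The mean oscillation of a bounded function that is continuous among the configurations with a
fixed number of points. -/
lemma tendsto_meanOsc_zero (hL : IsPoissonLaw ν L) (hν : ∀ ζ : S, ν {ζ} = 0) {x : Config S}
    (hFx : 0 < F x) (hFnear : Tendsto F (near x) (𝓝 (F x)))
    {K C : ℝ} (hK : 0 ≤ K) (hC : 0 ≤ C) (hF : ∀ᵐ y ∂L, F y ≤ K * C ^ y.points.card)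
    (hHm : Measurable H) (hHnear : Tendsto H (near x) (𝓝 (H x)))
    {M : ℝ} (hM : 0 ≤ M) (hH : ∀ y, |H x - H y| ≤ M)
    [IsFiniteMeasure (L.withDensity fun y => ENNReal.ofReal (F y))] :
    Tendsto (meanOsc (L.withDensity fun y => ENNReal.ofReal (F y)) H x) (𝓝[>] 0) (𝓝 0) := by
  set μ := L.withDensity fun y => ENNReal.ofReal (F y)
  rw [Metric.tendsto_nhds]
  intro ε hε
  have hη : 0 < ε / 3 / (M + 1) := by positivity
  have hnear : ∀ᶠ y in near x, |H x - H y| ≤ ε / 3 := by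
    filter_upwards [Metric.tendsto_nhds.1 hHnear (ε / 3) (by positivity)] with y hy
    rw [abs_sub_comm]
    exact hy.le
  filter_upwards [eventually_withDensity_le hL hν hFx hFnear hK hC hF hη,
    eventually_forall_of_eventually_near hnear, self_mem_nhdsWithin] with δ h1 h2 hδ
  have hδ0 : (0 : ℝ) ≤ δ := le_of_lt hδ
  have hG := measurableSet_equinumerousBall x hδ0
  have hB := measurableSet_hausdorffBall x hδ0
  have h1' : μ.real (hausdorffBall x δ \ equinumerousBall x δ) ≤
      ε / 3 / (M + 1) * μ.real (hausdorffBall x δ) := by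
    rw [← ENNReal.toReal_ofReal hη.le, measureReal_def, measureReal_def, ← ENNReal.toReal_mul]
    exact ENNReal.toReal_mono (ENNReal.mul_ne_top ENNReal.ofReal_ne_top (measure_ne_top _ _)) h1
  have hint : IntegrableOn (fun y => |H x - H y|) (hausdorffBall x δ) μ :=
    (Integrable.of_bound ((measurable_const.sub hHm).abs.aestronglyMeasurable) M
      (ae_of_all _ fun y => by simpa using hH y)).integrableOn
  have hbound : ∫ y in hausdorffBall x δ, |H x - H y| ∂μ ≤
      2 * ε / 3 * μ.real (hausdorffBall x δ) := by
    have hsplit := integral_inter_add_sdiff hG hint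
    have hsub : hausdorffBall x δ ∩ equinumerousBall x δ = equinumerousBall x δ :=
      Set.inter_eq_right.2 fun y hy => hy.1
    rw [← hsplit, hsub]
    have i1 : ∫ y in equinumerousBall x δ, |H x - H y| ∂μ ≤
        ε / 3 * μ.real (equinumerousBall x δ) := by
      exact (le_abs_self _).trans (norm_setIntegral_le_of_norm_le_const
        (f := fun y => |H x - H y|) (measure_lt_top μ _) fun y hy => by simpa using h2 y hy)
    have i2 : ∫ y in hausdorffBall x δ \ equinumerousBall x δ, |H x - H y| ∂μ ≤
        M * μ.real (hausdorffBall x δ \ equinumerousBall x δ) := by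
      exact (le_abs_self _).trans (norm_setIntegral_le_of_norm_le_const
        (f := fun y => |H x - H y|) (measure_lt_top μ _) fun y _ => by simpa using hH y)
    have i3 : μ.real (equinumerousBall x δ) ≤ μ.real (hausdorffBall x δ) :=
      measureReal_mono fun y hy => hy.1
    have i4 : M * (ε / 3 / (M + 1)) ≤ ε / 3 := by
      rw [mul_div_assoc', div_le_iff₀ (by positivity)]
      nlinarith
    have i5 := mul_le_mul_of_nonneg_left h1' hM
    have i6 := mul_le_mul_of_nonneg_right i4 (measureReal_nonneg (μ := μ) (s := hausdorffBall x δ))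
    have i7 := mul_le_mul_of_nonneg_left i3 (by positivity : 0 ≤ ε / 3)
    linarith
  have hnonneg : 0 ≤ meanOsc μ H x δ :=
    mul_nonneg (by positivity) (integral_nonneg fun _ => abs_nonneg _)
  rw [Real.dist_eq, sub_zero, abs_of_nonneg hnonneg, meanOsc]
  -- For a null ball the factor `1 / 0` is `0`, so the limit also holds off the support of `μ`.
  rcases (measureReal_nonneg (μ := μ) (s := hausdorffBall x δ)).eq_or_lt with h0 | h0
  · rw [← h0]; simpa using hε
  · rw [one_div, inv_mul_lt_iff₀ h0]
    nlinarith

end MeanOsc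

lemma meanOsc_congr {S : Type*} [MetricSpace S] [MeasurableSpace S] {μ : Measure (Config S)}
    {η η' : Config S → ℝ} (h : η =ᵐ[μ] η') {x : Config S} (hx : η x = η' x) :
    meanOsc μ η x = meanOsc μ η' x := by
  ext δ
  rw [meanOsc, meanOsc, hx]
  congr 1
  refine integral_congr_ae (ae_restrict_of_ae ?_)
  filter_upwards [h] with y hy
  rw [hy]

/-! ### Bayes' formula. -/

section Regression

variable {S Ω : Type*} [MeasurableSpace S] [MeasurableSpace Ω] {P : Measure Ω}
  {M : ℕ} {X : Ω → Config S} {Y : Ω → Fin (M + 1)}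
  {L : Measure (Config S)} {f : Fin (M + 1) → Config S → ℝ}

lemma map_eq_withDensity_sum (hX : Measurable X) (hY : Measurable Y)
    (hfm : ∀ j, Measurable (f j)) (hf0 : ∀ j y, 0 ≤ f j y)
    (hjoint : ∀ j A, MeasurableSet A →
      P (X ⁻¹' A ∩ Y ⁻¹' {j}) = ∫⁻ y in A, ENNReal.ofReal (f j y) ∂L) :
    P.map X = L.withDensity fun y => ENNReal.ofReal (∑ j, f j y) := by
  ext A hA
  rw [Measure.map_apply hX hA, withDensity_apply _ hA]
  simp_rw [ENNReal.ofReal_sum_of_nonneg fun j _ => hf0 j _]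
  rw [lintegral_finsetSum _ fun j _ => (hfm j).ennreal_ofReal]
  simp_rw [← hjoint _ A hA]
  rw [← measure_biUnion_finset]
  · congr 1
    ext ω; simp
  · intro i _ j _ hij
    exact Disjoint.inter_left' _ (Disjoint.inter_right' _
      (Disjoint.preimage _ (by simpa using hij)))
  · exact fun j _ => (hX hA).inter (hY (measurableSet_singleton j))

/-- Bayes' formula for the regression function. -/
lemma isRegressionFunction_div [IsProbabilityMeasure P] (hX : Measurable X) (hY : Measurable Y)
    (hfm : ∀ j, Measurable (f j)) (hf0 : ∀ j y, 0 ≤ f j y) (hpos : ∀ y, 0 < ∑ j, f j y)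
    (hjoint : ∀ j A, MeasurableSet A →
      P (X ⁻¹' A ∩ Y ⁻¹' {j}) = ∫⁻ y in A, ENNReal.ofReal (f j y) ∂L) :
    IsRegressionFunction P X Y fun y => (∑ j : Fin (M + 1), ((j : ℕ) : ℝ) * f j y) / ∑ j, f j y := by
  set H : Config S → ℝ := fun y => (∑ j : Fin (M + 1), ((j : ℕ) : ℝ) * f j y) / ∑ j, f j y with hH
  have hHm : Measurable H := (Finset.measurable_sum _ fun j _ => (hfm j).const_mul _).div
    (Finset.measurable_sum _ fun j _ => hfm j)
  have hH0 : ∀ y, 0 ≤ H y := fun y => div_nonneg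
    (Finset.sum_nonneg fun j _ => mul_nonneg (Nat.cast_nonneg _) (hf0 j y)) (hpos y).le
  have hHM : ∀ y, H y ≤ M := fun y => by
    rw [hH, div_le_iff₀ (hpos y), Finset.mul_sum]
    refine Finset.sum_le_sum fun j _ => mul_le_mul_of_nonneg_right ?_ (hf0 j y)
    exact_mod_cast Nat.lt_succ_iff.1 j.2
  have hYm : Measurable fun ω => ((Y ω : ℕ) : ℝ) :=
    (measurable_from_top (f := fun j : Fin (M + 1) => ((j : ℕ) : ℝ))).comp hY
  refine ⟨hHm, ae_eq_condExp_of_forall_setIntegral_eq hX.comap_le ?_ ?_ ?_ ?_⟩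
  · refine Integrable.of_bound hYm.aestronglyMeasurable M (ae_of_all _ fun ω => ?_)
    rw [Real.norm_of_nonneg (Nat.cast_nonneg _)]
    exact_mod_cast Nat.lt_succ_iff.1 (Y ω).2
  · intro s _ _
    refine (Integrable.of_bound (hHm.comp hX).aestronglyMeasurable M
      (ae_of_all _ fun ω => ?_)).integrableOn
    rw [Function.comp_apply, Real.norm_of_nonneg (hH0 _)]
    exact hHM _
  · rintro _ ⟨A, hA, rfl⟩ -
    rw [integral_eq_lintegral_of_nonneg_ae (ae_of_all _ fun ω => hH0 _)
      (hHm.comp hX).aestronglyMeasurable, integral_eq_lintegral_of_nonneg_ae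
      (ae_of_all _ fun ω => Nat.cast_nonneg _) hYm.aestronglyMeasurable]
    congr 1
    -- Against the density `∑ f j`, the denominator of `H` cancels.
    have e1 : ∫⁻ ω in X ⁻¹' A, ENNReal.ofReal (H (X ω)) ∂P =
        ∑ j : Fin (M + 1), ENNReal.ofReal (j : ℕ) * P (X ⁻¹' A ∩ Y ⁻¹' {j}) := by
      rw [← setLIntegral_map hA hHm.ennreal_ofReal hX, map_eq_withDensity_sum hX hY hfm hf0 hjoint,
        setLIntegral_withDensity_eq_setLIntegral_mul _
          (Finset.measurable_sum _ fun j _ => hfm j).ennreal_ofReal hHm.ennreal_ofReal hA]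
      simp_rw [hjoint _ A hA]
      simp_rw [← lintegral_const_mul' _ _ ENNReal.ofReal_ne_top]
      rw [← lintegral_finsetSum _ fun j _ => (hfm j).ennreal_ofReal.const_mul _]
      refine lintegral_congr fun y => ?_
      rw [Pi.mul_apply, ← ENNReal.ofReal_mul (hpos y).le, hH, mul_div_cancel₀ _ (hpos y).ne',
        ENNReal.ofReal_sum_of_nonneg fun j _ => mul_nonneg (Nat.cast_nonneg _) (hf0 j y)]
      exact Finset.sum_congr rfl fun j _ => ENNReal.ofReal_mul (Nat.cast_nonneg _)
    have e2 : ∫⁻ ω in X ⁻¹' A, ENNReal.ofReal (Y ω : ℕ) ∂P =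
        ∑ j : Fin (M + 1), ENNReal.ofReal (j : ℕ) * P (X ⁻¹' A ∩ Y ⁻¹' {j}) := by
      have hind : ∀ ω, ENNReal.ofReal (Y ω : ℕ) = ∑ j : Fin (M + 1),
          (Y ⁻¹' {j}).indicator (fun _ => ENNReal.ofReal (j : ℕ)) ω := fun ω => by
        rw [Finset.sum_eq_single (Y ω) (fun j _ hj => ?_) (by simp)]
        · rw [Set.indicator_of_mem (show ω ∈ Y ⁻¹' {Y ω} from rfl)]
        · rw [Set.indicator_of_notMem (show ω ∉ Y ⁻¹' {j} from fun h => hj (Eq.symm h))]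
      simp_rw [hind]
      have hm : ∀ j : Fin (M + 1), MeasurableSet (Y ⁻¹' {j}) := fun j =>
        hY (measurableSet_singleton j)
      rw [lintegral_finsetSum _ fun j _ => measurable_const.indicator (hm j)]
      refine Finset.sum_congr rfl fun j _ => ?_
      rw [lintegral_indicator_const (hm j), Measure.restrict_apply (hm j), Set.inter_comm]
    exact e1.trans e2.symm
  · exact (hHm.comp (Measurable.of_comap_le le_rfl)).aestronglyMeasurable

end Regression

/-! ### From the conditional Gibbs laws to a joint density. -/

section Mixture

variable {S : Type*} [MetricSpace S] [MeasurableSpace S] {ν : Measure S}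

/-- Some label has positive probability, and its Gibbs law comes with a Poisson law. The label also
serves to make the mixture density positive. -/
lemma exists_isPoissonLaw {Ω : Type*} [MeasurableSpace Ω] {P : Measure Ω} [IsProbabilityMeasure P]
    {M : ℕ} {X : Ω → Config S} {Y : Ω → Fin (M + 1)} {φ : Fin (M + 1) → S → ℝ}
    {ψ : Fin (M + 1) → ℝ → ℝ}
    (hGibbs : ∀ j, P (Y ⁻¹' {j}) ≠ 0 →
      IsGibbsLaw ν (φ j) (ψ j) ((cond P (Y ⁻¹' {j})).map X)) :
    ∃ j, P (Y ⁻¹' {j}) ≠ 0 ∧ ∃ L : Measure (Config S), IsPoissonLaw ν L := by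
  obtain ⟨j, hj⟩ : ∃ j, P (Y ⁻¹' {j}) ≠ 0 := by
    by_contra! h
    have h0 : P (⋃ j, Y ⁻¹' {j}) = 0 := measure_iUnion_null h
    rw [← Set.preimage_iUnion, Set.iUnion_of_singleton, Set.preimage_univ, measure_univ] at h0
    exact one_ne_zero h0
  obtain ⟨L, hL, -⟩ := hGibbs j hj
  exact ⟨j, hj, L, hL⟩

/-- The joint law of a Gibbs process and its label, relative to a given Poisson law. -/
lemma exists_joint_density [CompactSpace S] [BorelSpace S] [IsFiniteMeasure ν]
    {L : Measure (Config S)} (hL : IsPoissonLaw ν L) {φ : S → ℝ} {ψ : ℝ → ℝ}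
    (hφ : Continuous φ) (hψ : ContinuousOn ψ (Set.Ici 0))
    {Ω : Type*} [MeasurableSpace Ω] {P : Measure Ω} [IsFiniteMeasure P] {X : Ω → Config S}
    (hX : Measurable X) {B : Set Ω} (hB : MeasurableSet B)
    (hGibbs : P B ≠ 0 → IsGibbsLaw ν φ ψ ((cond P B).map X)) :
    ∃ a C : ℝ, 0 ≤ a ∧ 0 ≤ C ∧ (P B ≠ 0 → 0 < a) ∧
      (∀ A, MeasurableSet A → P (X ⁻¹' A ∩ B) =
        ∫⁻ y in A, ENNReal.ofReal (a * Real.exp (-energy φ ψ y)) ∂L) ∧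
      ∀ᵐ y ∂L, a * Real.exp (-energy φ ψ y) ≤ a * Real.exp C ^ y.points.card := by
  by_cases h0 : P B = 0
  · refine ⟨0, 0, le_rfl, le_rfl, fun h => absurd h0 h, fun A _ => ?_, by simp⟩
    simp [measure_mono_null Set.inter_subset_right h0]
  obtain ⟨L', hL', hint, c, hc, hQ⟩ := hGibbs h0
  -- Each Gibbs law brings its own Poisson law; uniqueness gives all labels the same reference
  -- measure.
  obtain rfl := hL.unique hL'
  obtain ⟨C, hC⟩ := exists_exp_neg_energy_le hL hφ hψ hint
  have hpos : 0 < P.real B := ENNReal.toReal_pos h0 (measure_ne_top _ _)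
  refine ⟨P.real B * c, |C|, by positivity, abs_nonneg C, fun _ => by positivity,
    fun A hA => ?_, ?_⟩
  · have h1 := congrArg (fun Q : Measure (Config S) => P B * Q A) hQ
    simp only [Measure.map_apply hX hA, cond_apply hB, withDensity_apply _ hA] at h1
    rw [← mul_assoc, ENNReal.mul_inv_cancel h0 (measure_ne_top _ _), one_mul, Set.inter_comm] at h1
    rw [h1, ← lintegral_const_mul' _ _ (measure_ne_top _ _)]
    refine lintegral_congr fun y => ?_
    rw [mul_assoc, ENNReal.ofReal_mul hpos.le, ofReal_measureReal]
  · filter_upwards [hL.ae_mem_support] with y hy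
    rw [← Real.exp_nat_mul]
    refine mul_le_mul_of_nonneg_left (Real.exp_le_exp.2 ((hC y hy).trans ?_)) (by positivity)
    rw [mul_comm]
    exact mul_le_mul_of_nonneg_left (le_abs_self C) (Nat.cast_nonneg _)

end Mixture

/-- A function whose mean oscillation vanishes almost everywhere satisfies the Besicovitch
condition, and so do the functions that are almost everywhere equal to it. -/
lemma besicovitchCondition_of_ae_eq {S : Type*} [MetricSpace S] [MeasurableSpace S]
    {μ : Measure (Config S)} {η η' : Config S → ℝ} (h : η =ᵐ[μ] η')
    (h0 : ∀ᵐ x ∂μ, Tendsto (meanOsc μ η' x) (𝓝[>] 0) (𝓝 0)) : BesicovitchCondition μ η := by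
  refine tendsto_const_nhds.congr' ?_
  filter_upwards [self_mem_nhdsWithin] with ε hε
  have hl : ∀ᵐ x ∂μ, ∃ l : ℝ, l ≤ ε ∧ Tendsto (meanOsc μ η x) (𝓝[>] 0) (𝓝 l) := by
    filter_upwards [h, h0] with x hx hx0
    exact ⟨0, le_of_lt hε, by rw [meanOsc_congr h hx]; exact hx0⟩
  exact (ae_iff.1 hl).symm

end PointConfig

/-! ### The theorem. -/

theorem mainTheorem4 {S : Type*} [MetricSpace S] [CompactSpace S] [MeasurableSpace S]
    [BorelSpace S] (ν : Measure S) [IsFiniteMeasure ν] (hν : ∀ ζ : S, ν {ζ} = 0)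
    {Ω : Type*} [MeasurableSpace Ω] (P : Measure Ω) [IsProbabilityMeasure P]
    (M : ℕ) (X : Ω → PointConfig.Config S) (Y : Ω → Fin (M + 1)) (hX : Measurable X) (hY : Measurable Y)
    (φ : Fin (M + 1) → S → ℝ) (ψ : Fin (M + 1) → ℝ → ℝ)
    (hφ : ∀ j, Continuous (φ j)) (hψ : ∀ j, ContinuousOn (ψ j) (Set.Ici 0))
    (hGibbs : ∀ j, P (Y ⁻¹' {j}) ≠ 0 →
      PointConfig.IsGibbsLaw ν (φ j) (ψ j) ((ProbabilityTheory.cond P (Y ⁻¹' {j})).map X)) :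
    (∀ η : PointConfig.Config S → ℝ, PointConfig.IsRegressionFunction P X Y η →
      PointConfig.BesicovitchCondition (P.map X) η) ∧
    (∃ η : PointConfig.Config S → ℝ, PointConfig.IsRegressionFunction P X Y η ∧
      ∀ x : PointConfig.Config S, (∀ δ > 0, (P.map X) (PointConfig.hausdorffBall x δ) ≠ 0) →
        Tendsto (PointConfig.meanOsc (P.map X) η x) (𝓝[>] 0) (𝓝 0)) := by
  classical
  obtain ⟨j₀, hj₀, L, hL⟩ := PointConfig.exists_isPoissonLaw hGibbs
  choose a C ha hC hapos hjoint hle using fun j => PointConfig.exists_joint_density hL (hφ j)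
    (hψ j) hX (hY (measurableSet_singleton j)) (hGibbs j)
  let f : Fin (M + 1) → PointConfig.Config S → ℝ := fun j y =>
    a j * Real.exp (-PointConfig.energy (φ j) (ψ j) y)
  have hfm : ∀ j, Measurable (f j) := fun j =>
    (Real.measurable_exp.comp (PointConfig.measurable_energy (hφ j) (hψ j)).neg).const_mul _
  have hf0 : ∀ j y, 0 ≤ f j y := fun j y => mul_nonneg (ha j) (Real.exp_nonneg _)
  have hpos : ∀ y, 0 < ∑ j, f j y := fun y =>
    Finset.sum_pos' (fun j _ => hf0 j y)
      ⟨j₀, Finset.mem_univ _, mul_pos (hapos j₀ hj₀) (Real.exp_pos _)⟩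
  have hreg := PointConfig.isRegressionFunction_div hX hY hfm hf0 hpos hjoint
  set H : PointConfig.Config S → ℝ :=
    fun y => (∑ j : Fin (M + 1), ((j : ℕ) : ℝ) * f j y) / ∑ j, f j y with hHdef
  have hH0 : ∀ y, 0 ≤ H y := fun y => div_nonneg
    (Finset.sum_nonneg fun j _ => mul_nonneg (Nat.cast_nonneg _) (hf0 j y)) (hpos y).le
  have hHM : ∀ y, H y ≤ M := fun y => by
    rw [hHdef, div_le_iff₀ (hpos y), Finset.mul_sum]
    refine Finset.sum_le_sum fun j _ => mul_le_mul_of_nonneg_right ?_ (hf0 j y)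
    exact_mod_cast Nat.lt_succ_iff.1 j.2
  have hfnear : ∀ j x, Tendsto (f j) (PointConfig.near x) (𝓝 (f j x)) := fun j x =>
    ((Real.continuous_exp.tendsto _).comp
      (PointConfig.tendsto_energy_near (hφ j) (hψ j) x).neg).const_mul _
  have hFnear : ∀ x, Tendsto (fun y => ∑ j, f j y) (PointConfig.near x) (𝓝 (∑ j, f j x)) :=
    fun x => tendsto_finsetSum _ fun j _ => hfnear j x
  have hHnear : ∀ x, Tendsto H (PointConfig.near x) (𝓝 (H x)) := fun x =>
    (tendsto_finsetSum _ fun j _ => (hfnear j x).const_mul _).div (hFnear x) (hpos x).ne'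
  -- As every `C j` is nonnegative, their sum dominates each of them.
  have hF : ∀ᵐ y ∂L, ∑ j, f j y ≤ (∑ j, a j) * Real.exp (∑ j, C j) ^ y.points.card := by
    filter_upwards [ae_all_iff.2 hle] with y hy
    rw [Finset.sum_mul]
    refine Finset.sum_le_sum fun j _ => (hy j).trans (mul_le_mul_of_nonneg_left ?_ (ha j))
    exact pow_le_pow_left₀ (Real.exp_nonneg _) (Real.exp_le_exp.2
      (Finset.single_le_sum (fun i _ => hC i) (Finset.mem_univ j))) _
  have hmap := PointConfig.map_eq_withDensity_sum hX hY hfm hf0 hjoint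
  have hfin : IsFiniteMeasure (L.withDensity fun y => ENNReal.ofReal (∑ j, f j y)) := by
    rw [← hmap]; infer_instance
  have hosc : ∀ x, Tendsto (PointConfig.meanOsc (P.map X) H x) (𝓝[>] 0) (𝓝 0) := fun x => by
    rw [hmap]
    exact PointConfig.tendsto_meanOsc_zero hL hν (hpos x) (hFnear x)
      (Finset.sum_nonneg fun j _ => ha j) (Real.exp_nonneg _) hF hreg.1 (hHnear x)
      (Nat.cast_nonneg M) fun y => abs_sub_le_iff.2
        ⟨by linarith [hH0 y, hHM x], by linarith [hH0 x, hHM y]⟩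
  refine ⟨fun η hη => ?_, H, hreg, fun x _ => hosc x⟩
  refine PointConfig.besicovitchCondition_of_ae_eq ?_ (ae_of_all _ hosc)
  exact (ae_map_iff hX.aemeasurable (measurableSet_eq_fun hη.1 hreg.1)).2
    (hη.2.trans hreg.2.symm)
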